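/- (i) Let $V$ be a finite-dimensional real vector space and let $\nu$ be a positive definite quadratic form on $V$. Then $x\mapsto|\nu(x)|^{1/2}$ is a norm on $V$. (ii) Let $k$ be a non-archimedean local field, that is, a locally compact field whose topology is given by a non-trivial non-archimedean absolute value $|\cdot|$ (of any characteristic). Let $V$ be a vector space over $k$ of finite dimension $m$, and let $r\ge 1$ be an integer with $r^2\ge m$. Then there is a function $\nu\colon V\to k$ given by a homogeneous polynomial of degree $r$ in the coordinates of $V$ such that (a) $\nu$ is definite, i.e. for $x\in V$, $\nu(x)=0$ if and only if $x=0$; (b) $N(x)=|\nu(x)|^{1/r}$ is a non-archimedean norm on $V$, i.e. a norm ($N(x)\ge 0$, $N(x)=0$ if and only if $x=0$, $N(ax)=|a|N(x)$ for $a\in k$) with $N(x+y)\le\max(N(x),N(y))$; (c) $\nu$ is the restriction to $V$ of the reduced norm of a central division algebra of dimension $r^2$: there are a division algebra $D$ with centre $k$ and $\dim_k D=r^2$ and an injective $k$-linear map $\iota\colon V\to D$ with $\nu=\mathrm{Nrd}_D\circ\iota$. Here $\mathrm{Nrd}_D\colon D\to k$ is the reduced norm, characterized by $\mathrm{Nrd}_D(a)=\det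 F(1\otimes a)$ for every extension field $K$ of $k$ and every isomorphism of $K$-algebras $F\colon K\otimes_k D\to M_r(K)$ (such $K$ and $F$ exist). -/

import Mathlib

open scoped TensorProduct

universe u v

/-- `N` is a norm on the vector space `V` over the normed field `k`. -/
structure IsVectorNorm (k : Type u) {V : Type v} [NormedField k] [AddCommGroup V] [Module k V]
    (N : V → ℝ) : Prop where
  nonneg : ∀ x, 0 ≤ N x
  eq_zero_iff : ∀ x, N x = 0 ↔ x = 0
  smul : ∀ (a : k) (x : V), N (a • x) = ‖a‖ * N x
  add_le : ∀ x y, N (x + y) ≤ N x + N y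

/-- `N` is a non-archimedean norm on the vector space `V` over the normed field `k`. -/
structure IsNonarchVectorNorm (k : Type u) {V : Type v} [NormedField k] [AddCommGroup V]
    [Module k V] (N : V → ℝ) : Prop extends IsVectorNorm k N where
  add_le_max : ∀ x y, N (x + y) ≤ max (N x) (N y)

/-- `f : V → k` is (the function given by) a homogeneous polynomial of degree `d` on the
finite-dimensional space `V`: in the coordinates of a basis of `V` it is given by a homogeneous
polynomial of degree `d`. A linear change of coordinates preserves such polynomials, so the
choice of the basis is immaterial. -/
def IsHomogeneousPolynomialFunction (k : Type u) {V : Type v} [Field k] [AddCommGroup V]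
    [Module k V] (d : ℕ) (f : V → k) : Prop :=
  ∃ (b : Module.Basis (Fin (Module.finrank k V)) k V)
    (P : MvPolynomial (Fin (Module.finrank k V)) k),
    P.IsHomogeneous d ∧ ∀ x, f x = MvPolynomial.eval (fun i => b.repr x i) P

/-- `ν : D → k` is the reduced norm of the `k`-algebra `D` of degree `r` (i.e. of dimension `r ^ 2`
over its centre `k`): `D` is split by some extension field of `k`, and for every extension field
`K` and every isomorphism `F` of `K ⊗ D` with the algebra of `r × r` matrices over `K`, one has
`ν a = det (F (1 ⊗ a))`. -/
structure IsReducedNorm (k : Type u) (D : Type u) [Field k] [Ring D] [Algebra k D] (r : ℕ)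
    (ν : D → k) : Prop where
  exists_splitting : ∃ (K : Type u) (_ : Field K) (_ : Algebra k K),
    Nonempty (K ⊗[k] D ≃ₐ[K] Matrix (Fin r) (Fin r) K)
  eq_det : ∀ (K : Type u) [Field K] [Algebra k K]
    (F : K ⊗[k] D ≃ₐ[K] Matrix (Fin r) (Fin r) K) (a : D),
    algebraMap k K (ν a) = (F (1 ⊗ₜ[k] a)).det

/-! ### Positive definite quadratic forms -/

/-! Part (i) is Cauchy–Schwarz for the bilinear form associated to the quadratic form.

For part (ii), only the dimension of V matters: it suffices to find a central division algebra D of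
dimension r² whose reduced norm has ultrametric absolute value, and to embed V linearly in D. Such a
D is the cyclic algebra of the unramified extension L/k of degree r, a generator σ of its Galois
group and a uniformizer π. It is realized by r × r matrices over L commuting with a σ-semilinear
weighted shift U with U ^ r = π, and a matrix M in it is determined by its first row x.

The key is a norm formula. With ρ ^ r = |π|, the entry norms of M become circulant after rescaling
by powers of ρ (`norm_apply_of_mem_cyclicAlgebra`). Since L is unramified, the nonzero values |x_j|
ρ ^ j lie in distinct cosets of the value group, so the largest is attained once; one term then
dominates the Leibniz expansion (`Matrix.norm_det_eq_of_dominant`), and |det M| = (max_j |x_j| ρ ^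
j) ^ r (`exists_norm_det_eq`). This single formula shows that det is definite, that D has no zero
divisors, and that |det| is ultrametric.

The determinant is fixed by σ, hence takes values in k. It is the reduced norm because every
homomorphism from D to r × r matrices over a field extends to a splitting, and automorphisms of a
matrix algebra preserve determinants. The extension L is obtained by adjoining roots of unity of
order q ^ r - 1, q being the size of the residue field; this works in every characteristic. -/

theorem QuadraticForm.PosDef.isVectorNorm {V : Type v} [AddCommGroup V] [Module ℝ V]
    {Q : QuadraticForm ℝ V} (hQ : Q.PosDef) :
    IsVectorNorm ℝ (fun x : V => |Q x| ^ ((1 : ℝ) / 2)) := by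
  have h0 : ∀ x, 0 ≤ Q x := hQ.nonneg
  have hN : (fun x : V => |Q x| ^ ((1 : ℝ) / 2)) = fun x => √(Q x) := by
    ext x; rw [abs_of_nonneg (h0 x), Real.sqrt_eq_rpow]
  rw [hN]
  refine ⟨fun x => Real.sqrt_nonneg _, fun x => ?_, fun a x => ?_, fun x y => ?_⟩
  · rw [Real.sqrt_eq_zero (h0 x)]
    exact ⟨fun h => hQ.anisotropic x h, fun h => by simp [h]⟩
  · rw [QuadraticMap.map_smul, smul_eq_mul, Real.sqrt_mul (mul_self_nonneg a),
      Real.sqrt_mul_self_eq_abs, Real.norm_eq_abs]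
  · have hB : ∀ z, QuadraticMap.associated (R := ℝ) Q z z = Q z := fun z =>
      QuadraticMap.associated_eq_self_apply ℝ Q z
    have hcs := LinearMap.BilinForm.apply_sq_le_of_symm (QuadraticMap.associated (R := ℝ) Q)
      (fun z => by rw [hB]; exact h0 z)
      ⟨fun z w => QuadraticMap.associated_isSymm ℝ Q z w⟩ x y
    have hadd : Q (x + y) = Q x + Q y + 2 * QuadraticMap.associated (R := ℝ) Q x y := by
      rw [QuadraticMap.associated_apply]
      simp
    rw [hB, hB] at hcs
    apply Real.sqrt_le_iff.mpr
    refine ⟨by positivity, ?_⟩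
    have h1 : QuadraticMap.associated (R := ℝ) Q x y ≤ √(Q x) * √(Q y) := by
      rw [← Real.sqrt_mul (h0 x)]
      exact Real.le_sqrt_of_sq_le hcs
    rw [hadd, add_sq, Real.sq_sqrt (h0 x), Real.sq_sqrt (h0 y)]
    linarith

/-! ### Scalar extension of central division algebras -/

section SkolemNoether

variable {k D Ω B : Type*} [Field k] [Ring D] [Algebra k D] [Field Ω] [Algebra k Ω] [Ring B]
  [Algebra Ω B] [Algebra k B] [IsScalarTower k Ω B]

/-- The `Ω`-linear extension of a `k`-algebra homomorphism. -/
noncomputable def AlgHom.scalarExtension (f : D →ₐ[k] B) : Ω ⊗[k] D →ₐ[Ω] B :=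
  Algebra.TensorProduct.lift (Algebra.ofId Ω B) f fun a b => by
    rw [Algebra.ofId_apply]
    exact Algebra.commute_algebraMap_left a (f b)

theorem AlgHom.scalarExtension_tmul (f : D →ₐ[k] B) (w : Ω) (a : D) :
    AlgHom.scalarExtension f (w ⊗ₜ[k] a) = w • f a := by
  rw [AlgHom.scalarExtension, Algebra.TensorProduct.lift_tmul, Algebra.ofId_apply,
    Algebra.smul_def]

variable [IsDomain D] [FiniteDimensional k D] [Algebra.IsCentral k D] [Nontrivial B]

/-- A relation `∑ ωᵢ f(dᵢ) = 0` with `ωᵢ` linearly independent over the centre of `D` is trivial. -/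
theorem AlgHom.eq_zero_of_sum_smul_eq_zero (f : D →ₐ[k] B) {ι : Type*} {ω : ι → Ω}
    (hω : LinearIndependent k ω) (d : ι →₀ D)
    (hd : d.sum (fun i x => ω i • f x) = 0) : d = 0 := by
  classical
  -- Shortest-relation argument: scale one coefficient to 1; commutators with any `a` then give a
  -- strictly shorter relation, so all coefficients are central and hence lie in k.
  induction hn : d.support.card using Nat.strong_induction_on generalizing d with
  | _ n ih =>
  by_contra hne
  obtain ⟨j, hj⟩ := Finsupp.ne_iff.mp hne
  rw [Finsupp.zero_apply] at hj
  let : DivisionRing D := divisionRingOfFiniteDimensional k D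
  set e : ι →₀ D := d.mapRange (fun x => (d j)⁻¹ * x) (mul_zero _) with he
  have hej : e j = 1 := by simp [he, inv_mul_cancel₀ hj]
  have hsupp : e.support ⊆ d.support := Finsupp.support_mapRange
  have hsum : ∀ (s : ι →₀ D), s.support ⊆ d.support →
      s.sum (fun i x => ω i • f x) = ∑ i ∈ d.support, ω i • f (s i) := fun s hs =>
    Finsupp.sum_of_support_subset _ hs _ (by simp)
  have hd0 : ∑ i ∈ d.support, ω i • f (d i) = 0 := hd
  have he0 : ∑ i ∈ d.support, ω i • f (e i) = 0 := by
    have : ∑ i ∈ d.support, ω i • f (e i) = f (d j)⁻¹ * ∑ i ∈ d.support, ω i • f (d i) := by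
      rw [Finset.mul_sum]
      refine Finset.sum_congr rfl fun i _ => ?_
      rw [mul_smul_comm, ← map_mul]
      simp [he]
    rw [this, hd0, mul_zero]
  have hcomm : ∀ a : D, ∀ i, a * e i = e i * a := by
    intro a i
    have key := ih _ ?_ (e.mapRange (fun x => a * x - x * a) (by simp)) ?_ rfl
    · have := DFunLike.congr_fun key i
      simpa [sub_eq_zero] using this
    · rw [← hn]
      apply Finset.card_lt_card
      refine ⟨(Finsupp.support_mapRange).trans hsupp, fun h => ?_⟩
      have := h (Finsupp.mem_support_iff.mpr hj)
      simp [hej] at this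
    · rw [hsum _ ((Finsupp.support_mapRange).trans hsupp)]
      have : ∑ i ∈ d.support, ω i • f ((e.mapRange (fun x => a * x - x * a) (by simp)) i)
          = f a * (∑ i ∈ d.support, ω i • f (e i)) - (∑ i ∈ d.support, ω i • f (e i)) * f a := by
        rw [Finset.mul_sum, Finset.sum_mul, ← Finset.sum_sub_distrib]
        refine Finset.sum_congr rfl fun i _ => ?_
        rw [Finsupp.mapRange_apply, map_sub, map_mul, map_mul, smul_sub, mul_smul_comm,
          smul_mul_assoc]
      rw [this, he0, mul_zero, zero_mul, sub_zero]
  have hc : ∀ i, ∃ c : k, algebraMap k D c = e i := fun i => by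
    have : e i ∈ Subalgebra.center k D := Subalgebra.mem_center_iff.mpr fun a => hcomm a i
    rw [Algebra.IsCentral.center_eq_bot] at this
    exact Algebra.mem_bot.mp this
  choose c hc using hc
  have h1 : algebraMap Ω B (∑ i ∈ d.support, c i • ω i) = 0 := by
    rw [← he0, map_sum]
    refine Finset.sum_congr rfl fun i _ => ?_
    rw [← hc i, AlgHom.commutes, IsScalarTower.algebraMap_apply k Ω B, Algebra.smul_def,
      Algebra.smul_def, ← map_mul, mul_comm]
  rw [map_eq_zero_iff _ (algebraMap Ω B).injective] at h1
  have h2 := linearIndependent_iff'.mp hω _ _ h1 j (Finsupp.mem_support_iff.mpr hj)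
  have := hc j
  rw [h2, hej, map_zero] at this
  exact zero_ne_one this

theorem AlgHom.scalarExtension_injective (f : D →ₐ[k] B) :
    Function.Injective (AlgHom.scalarExtension (Ω := Ω) f) := by
  classical
  rw [injective_iff_map_eq_zero]
  intro z hz
  let b := Module.Basis.ofVectorSpace k Ω
  obtain ⟨d, rfl⟩ := (TensorProduct.equivFinsuppOfBasisLeft b).symm.surjective z
  have : d = 0 := by
    apply AlgHom.eq_zero_of_sum_smul_eq_zero f b.linearIndependent
    rw [TensorProduct.equivFinsuppOfBasisLeft_symm_apply] at hz
    rw [← hz, Finsupp.sum, Finsupp.sum, map_sum]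
    refine Finset.sum_congr rfl fun i _ => ?_
    rw [AlgHom.scalarExtension_tmul]
  rw [this, map_zero]

/-- A `k`-algebra homomorphism from a central division algebra of degree `r` to the `r × r` matrices
over an extension field splits the algebra. -/
noncomputable def AlgHom.splitting {r : ℕ} [NeZero r] (f : D →ₐ[k] Matrix (Fin r) (Fin r) Ω)
    (hD : Module.finrank k D = r ^ 2) : Ω ⊗[k] D ≃ₐ[Ω] Matrix (Fin r) (Fin r) Ω :=
  AlgEquiv.ofBijective (AlgHom.scalarExtension f) <| by
    have hinj := AlgHom.scalarExtension_injective (Ω := Ω) f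
    refine ⟨hinj, ?_⟩
    refine (LinearMap.injective_iff_surjective_of_finrank_eq_finrank
      (f := (AlgHom.scalarExtension (Ω := Ω) f).toLinearMap) ?_).mp hinj
    rw [Module.finrank_baseChange, hD, Module.finrank_matrix]
    simp [sq]

theorem AlgHom.splitting_tmul {r : ℕ} [NeZero r] (f : D →ₐ[k] Matrix (Fin r) (Fin r) Ω)
    (hD : Module.finrank k D = r ^ 2) (a : D) : f.splitting hD (1 ⊗ₜ[k] a) = f a := by
  exact (AlgHom.scalarExtension_tmul f (1 : Ω) a).trans (one_smul Ω (f a))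

/-- Automorphisms of a matrix algebra are inner, and conjugation preserves the determinant. -/
theorem Matrix.det_algEquiv {n : Type*} [Fintype n] [DecidableEq n]
    (F : Matrix n n Ω ≃ₐ[Ω] Matrix n n Ω) (A : Matrix n n Ω) : (F A).det = A.det := by
  let E : Matrix n n Ω ≃ₐ[Ω] Module.End Ω (n → Ω) := Matrix.toLinAlgEquiv'
  obtain ⟨T, hT⟩ := AlgEquiv.eq_linearEquivConjAlgEquiv ((E.symm.trans F).trans E)
  have h1 : E (F A) = T.conjAlgEquiv Ω (E A) := by
    rw [← hT]; simp
  have hdet : ∀ M : Matrix n n Ω, LinearMap.det (E M) = M.det := fun M => by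
    exact LinearMap.det_toLin' M
  rw [← hdet, ← hdet, h1]
  exact LinearMap.det_conj (E A) T

theorem AlgHom.det_eq_det {r : ℕ} [NeZero r] (hD : Module.finrank k D = r ^ 2)
    (f g : D →ₐ[k] Matrix (Fin r) (Fin r) Ω) (a : D) : (f a).det = (g a).det := by
  rw [← f.splitting_tmul hD, ← g.splitting_tmul hD,
    ← Matrix.det_algEquiv ((g.splitting hD).symm.trans (f.splitting hD)) (g.splitting hD _)]
  simp

end SkolemNoether

/-- One matrix representation over an algebraic extension L suffices: L and any splitting field K
both embed in an algebraic closure of K, where `AlgHom.det_eq_det` compares the two determinants. -/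
theorem isReducedNorm_of_algHom {k D L : Type u} [Field k] [Ring D] [IsDomain D] [Algebra k D]
    [FiniteDimensional k D] [Algebra.IsCentral k D] [Field L] [Algebra k L]
    [Algebra.IsAlgebraic k L] {r : ℕ} [NeZero r] (hD : Module.finrank k D = r ^ 2)
    (f : D →ₐ[k] Matrix (Fin r) (Fin r) L) (ν : D → k)
    (hν : ∀ a, algebraMap k L (ν a) = (f a).det) : IsReducedNorm k D r ν where
  exists_splitting := ⟨L, inferInstance, inferInstance, ⟨f.splitting hD⟩⟩
  eq_det K _ _ F a := by
    let i : L →ₐ[k] AlgebraicClosure K := IsAlgClosed.lift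
    let j : K →ₐ[k] AlgebraicClosure K := IsScalarTower.toAlgHom k K (AlgebraicClosure K)
    let F' : D →ₐ[k] Matrix (Fin r) (Fin r) K :=
      (F.toAlgHom.restrictScalars k).comp Algebra.TensorProduct.includeRight
    have h := AlgHom.det_eq_det hD (i.mapMatrix.comp f) (j.mapMatrix.comp F') a
    apply (j : K →+* AlgebraicClosure K).injective
    have h1 : ((i.mapMatrix.comp f) a).det = i (f a).det := (AlgHom.map_det i (f a)).symm
    have h2 : ((j.mapMatrix.comp F') a).det = j (F' a).det := (AlgHom.map_det j (F' a)).symm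
    rw [h1, h2, ← hν, AlgHom.commutes] at h
    rw [AlgHom.coe_toRingHom, AlgHom.commutes]
    exact h

/-! ### The determinant as a homogeneous polynomial function -/

/-- The determinant of a matrix of linear forms is homogeneous, but with coefficients in L. Applying
a k-linear retraction L → k to the coefficients gives a polynomial over k with the same values on V,
since these values already lie in k. -/
theorem isHomogeneousPolynomialFunction_of_det {k L : Type*} {V : Type v} [Field k] [Field L]
    [Algebra k L] [AddCommGroup V] [Module k V] [FiniteDimensional k V] {r : ℕ}
    (φ : V →ₗ[k] Matrix (Fin r) (Fin r) L) (ν : V → k)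
    (hν : ∀ x, algebraMap k L (ν x) = (φ x).det) : IsHomogeneousPolynomialFunction k r ν := by
  classical
  let b := Module.finBasis k V
  obtain ⟨p, hp⟩ := (Algebra.linearMap k L).exists_leftInverse_of_injective
    (LinearMap.ker_eq_bot.mpr (algebraMap k L).injective)
  let A : Matrix (Fin r) (Fin r) (MvPolynomial (Fin (Module.finrank k V)) L) :=
    Matrix.of fun s t => ∑ i, MvPolynomial.C (φ (b i) s t) * MvPolynomial.X i
  have hA : A.det.IsHomogeneous r := by
    rw [Matrix.det_apply]
    refine MvPolynomial.IsHomogeneous.sum _ _ _ fun τ _ => ?_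
    have : (∏ i, A (τ i) i).IsHomogeneous (∑ _i : Fin r, 1) := by
      refine MvPolynomial.IsHomogeneous.prod _ _ _ fun i _ => ?_
      refine MvPolynomial.IsHomogeneous.sum Finset.univ
        (fun l => MvPolynomial.C (φ (b l) (τ i) i) * MvPolynomial.X l) 1 fun l _ => ?_
      simpa using (MvPolynomial.isHomogeneous_C (Fin (Module.finrank k V)) (φ (b l) (τ i) i)).mul
        (MvPolynomial.isHomogeneous_X L l)
    rw [Finset.sum_const, Finset.card_univ, Fintype.card_fin, smul_eq_mul, mul_one] at this
    rcases Int.units_eq_one_or (Equiv.Perm.sign τ) with h | h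
    · simpa [h] using this
    · simpa [h] using this.neg
  have hev : ∀ x : V,
      MvPolynomial.eval (fun i => algebraMap k L (b.repr x i)) A.det = (φ x).det := by
    intro x
    rw [RingHom.map_det]
    congr 1
    ext s t
    have hx := congrArg (fun M => M s t) (congrArg φ (b.sum_repr x))
    simp only [map_sum, map_smul, Matrix.sum_apply, Matrix.smul_apply] at hx
    rw [← hx]
    simp [A, Algebra.smul_def, mul_comm]
  refine ⟨b, ∑ m ∈ A.det.support, MvPolynomial.monomial m (p (A.det.coeff m)), ?_, fun x => ?_⟩
  · refine MvPolynomial.IsHomogeneous.sum _ _ _ fun m hm => ?_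
    apply MvPolynomial.isHomogeneous_monomial
    rw [Finsupp.degree_eq_weight_one]
    exact hA (MvPolynomial.mem_support_iff.mp hm)
  · have h1 : p (algebraMap k L (ν x)) = ν x := LinearMap.congr_fun hp (ν x)
    rw [← h1, hν, ← hev, MvPolynomial.eval_eq, map_sum, map_sum]
    refine Finset.sum_congr rfl fun m _ => ?_
    rw [MvPolynomial.eval_monomial, mul_comm (A.det.coeff m)]
    simp_rw [← map_pow, ← map_prod]
    rw [← Algebra.smul_def, map_smul, smul_eq_mul, mul_comm]
    rfl

/-! ### Determinants with a dominant generalized diagonal -/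

/-- In each Leibniz term the factors `s` cancel, leaving the product of the `w (i - τ i)`. Strict
dominance of `w c` makes the permutation i ↦ i - c the only one of maximal norm, and in an
ultrametric sum it alone decides the norm. -/
theorem Matrix.norm_det_eq_of_dominant {L : Type*} [NormedField L] [IsUltrametricDist L] {r : ℕ}
    [NeZero r] (M : Matrix (Fin r) (Fin r) L) (w s : Fin r → ℝ) (hs : ∀ i, 0 < s i)
    (hM : ∀ i j, ‖M i j‖ * s j = w (j - i) * s i) (c : Fin r) (hc : ∀ i ≠ c, w i < w c) :
    ‖M.det‖ = w c ^ r := by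
  classical
  have hw : ∀ i, 0 ≤ w i := fun i => by
    have h := hM 0 i
    rw [sub_zero] at h
    exact nonneg_of_mul_nonneg_left (h ▸ mul_nonneg (norm_nonneg _) (hs i).le) (hs 0)
  have hterm : ∀ τ : Equiv.Perm (Fin r),
      ‖Equiv.Perm.sign τ • ∏ i, M (τ i) i‖ = ∏ i, w (i - τ i) := fun τ => by
    have h1 : ‖Equiv.Perm.sign τ • ∏ i, M (τ i) i‖ = ∏ i, ‖M (τ i) i‖ := by
      rcases Int.units_eq_one_or (Equiv.Perm.sign τ) with h | h <;> simp [h, norm_prod]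
    have h2 : (∏ i, ‖M (τ i) i‖) * ∏ i, s i = (∏ i, w (i - τ i)) * ∏ i, s i := by
      rw [← Finset.prod_mul_distrib, Finset.prod_congr rfl fun i _ => hM (τ i) i,
        Finset.prod_mul_distrib, Equiv.prod_comp τ s]
    rw [h1]
    exact mul_right_cancel₀ (Finset.prod_pos fun i _ => hs i).ne' h2
  let τ₀ : Equiv.Perm (Fin r) := Equiv.subRight c
  have hτ₀ : ∏ i, w (i - τ₀ i) = w c ^ r := by simp [τ₀]
  have hlt : ∀ τ ≠ τ₀, ∏ i, w (i - τ i) < w c ^ r := fun τ hτ => by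
    obtain ⟨j, hj⟩ : ∃ j, j - τ j ≠ c := by
      by_contra! h
      refine hτ (Equiv.ext fun j => ?_)
      rw [Equiv.subRight_apply, ← h j, sub_sub_cancel]
    have hpos : 0 < w c := (hw _).trans_lt (hc _ hj)
    have hle : ∀ i, w i ≤ w c := fun i => by
      by_cases h : i = c
      · rw [h]
      · exact (hc i h).le
    rw [← Finset.mul_prod_erase _ _ (Finset.mem_univ j)]
    calc w (j - τ j) * ∏ i ∈ Finset.univ.erase j, w (i - τ i)
        ≤ w (j - τ j) * ∏ i ∈ Finset.univ.erase j, w c :=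
          mul_le_mul_of_nonneg_left (Finset.prod_le_prod (fun i _ => hw _) fun i _ => hle _) (hw _)
      _ < w c * ∏ i ∈ Finset.univ.erase j, w c :=
          mul_lt_mul_of_pos_right (hc _ hj) (Finset.prod_pos fun i _ => hpos)
      _ = w c ^ r := by
          rw [Finset.mul_prod_erase _ (fun _ => w c) (Finset.mem_univ j)]
          simp
  rw [Matrix.det_apply, ← Finset.add_sum_erase _ _ (Finset.mem_univ τ₀)]
  have hne : (‖Equiv.Perm.sign τ₀ • ∏ i, M (τ₀ i) i‖) = w c ^ r := by rw [hterm, hτ₀]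
  rcases (Finset.univ.erase τ₀).eq_empty_or_nonempty with he | he
  · rw [he, Finset.sum_empty, add_zero, hne]
  · have hsum : ‖∑ τ ∈ Finset.univ.erase τ₀, Equiv.Perm.sign τ • ∏ i, M (τ i) i‖ < w c ^ r := by
      obtain ⟨τ, hτ, hle⟩ := IsUltrametricDist.exists_norm_finsetSum_le_of_nonempty he
        (fun τ : Equiv.Perm (Fin r) => Equiv.Perm.sign τ • ∏ i, M (τ i) i)
      refine hle.trans_lt ?_
      rw [hterm]
      exact hlt τ (Finset.ne_of_mem_erase hτ)
    rw [IsUltrametricDist.norm_add_eq_max_of_norm_ne_norm (by rw [hne]; exact hsum.ne'), hne]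
    exact max_eq_left hsum.le

/-! ### Cyclic algebras -/

section CyclicAlgebra

/-- The weights of the shift matrix: `π` at the wrap-around, `1` elsewhere. -/
def shiftWeight {L : Type*} [One L] (π : L) {r : ℕ} [NeZero r] (i : Fin r) : L :=
  if i + 1 = 0 then π else 1

variable {k L : Type*} [Field k] [Field L] [Algebra k L]

/-- The cyclic algebra attached to `σ` and `π`, realized inside the `r × r` matrices over `L` as
the matrices `M` with `U σ(M) = M U`, where `U` is the weighted cyclic shift with `U ^ r = π`. -/
def cyclicAlgebra (σ : L ≃ₐ[k] L) (π : k) (r : ℕ) [NeZero r] :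
    Subalgebra k (Matrix (Fin r) (Fin r) L) where
  carrier := {M | ∀ i j, shiftWeight (algebraMap k L π) i * σ (M (i + 1) (j + 1)) =
    M i j * shiftWeight (algebraMap k L π) j}
  mul_mem' {M N} hM hN i j := by
    rw [Matrix.mul_apply, Matrix.mul_apply, map_sum, Finset.mul_sum, Finset.sum_mul,
      ← Equiv.sum_comp (Equiv.addRight (1 : Fin r))]
    refine Finset.sum_congr rfl fun l _ => ?_
    rw [Equiv.coe_addRight, map_mul, ← mul_assoc, hM, mul_assoc, hN, mul_assoc]
  add_mem' {M N} hM hN i j := by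
    rw [Matrix.add_apply, Matrix.add_apply, map_add, mul_add, add_mul, hM, hN]
  algebraMap_mem' a i j := by
    rw [Matrix.algebraMap_matrix_apply, Matrix.algebraMap_matrix_apply]
    by_cases h : i = j
    · subst h
      simp [mul_comm]
    · simp [h]

variable {σ : L ≃ₐ[k] L} {π : k} {r : ℕ} [NeZero r]

theorem shiftWeight_ne_zero (hπ : π ≠ 0) (i : Fin r) :
    shiftWeight (algebraMap k L π) i ≠ 0 := by
  unfold shiftWeight
  split_ifs
  · simpa using hπ
  · exact one_ne_zero

theorem Fin.val_add_one_eq_ite (i : Fin r) :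
    ((i + 1 : Fin r) : ℕ) = if i + 1 = 0 then 0 else (i : ℕ) + 1 := by
  split_ifs with h
  · rw [h]; rfl
  · have h1 : ((i + 1 : Fin r) : ℕ) = ((i : ℕ) + 1) % r := by
      rw [Fin.val_add, Fin.val_one', Nat.add_mod_mod]
    have h2 : (i : ℕ) + 1 ≠ r := fun h3 => h (Fin.ext (by rw [h1, h3, Nat.mod_self]; rfl))
    rw [h1, Nat.mod_eq_of_lt (by omega)]

theorem Fin.val_add_one_of_add_one_eq_zero {i : Fin r} (h : i + 1 = 0) : (i : ℕ) + 1 = r := by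
  have h1 : ((i + 1 : Fin r) : ℕ) = ((i : ℕ) + 1) % r := by
    rw [Fin.val_add, Fin.val_one', Nat.add_mod_mod]
  rw [h] at h1
  have h3 : ((i : ℕ) + 1) % r = 0 := h1.symm
  have := Nat.le_of_dvd (by omega) (Nat.dvd_of_mod_eq_zero h3)
  omega

theorem apply_inv_pow_val_add_one (hσ : σ ^ r = 1) (i : Fin r) (x : L) :
    σ ((σ⁻¹ ^ ((i + 1 : Fin r) : ℕ)) x) = (σ⁻¹ ^ (i : ℕ)) x := by
  have h : ∀ n : ℕ, σ ((σ⁻¹ ^ (n + 1)) x) = (σ⁻¹ ^ n) x := fun n => by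
    rw [pow_succ', ← AlgEquiv.mul_apply, ← mul_assoc, mul_inv_cancel, one_mul]
  rw [Fin.val_add_one_eq_ite]
  split_ifs with hi
  · rw [← h (i : ℕ), Fin.val_add_one_of_add_one_eq_zero hi, inv_pow σ r, hσ, inv_one, pow_zero]
  · exact h _

/-- The element of the cyclic algebra with first row `x`. -/
def cyclicMatrix (σ : L ≃ₐ[k] L) (π : k) (x : Fin r → L) : Matrix (Fin r) (Fin r) L :=
  Matrix.of fun i j => (σ⁻¹ ^ (i : ℕ)) (x (j - i)) *
    (if (j : ℕ) < (i : ℕ) then algebraMap k L π else 1)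

theorem cyclicMatrix_mem (hσ : σ ^ r = 1) (x : Fin r → L) :
    cyclicMatrix σ π x ∈ cyclicAlgebra σ π r := by
  intro i j
  -- Shifting both indices changes whether an entry lies below the diagonal exactly when one index
  -- alone wraps around; the shift weights compensate for this.
  have hw : shiftWeight (algebraMap k L π) i *
      (if ((j + 1 : Fin r) : ℕ) < ((i + 1 : Fin r) : ℕ) then algebraMap k L π else 1) =
      (if (j : ℕ) < (i : ℕ) then algebraMap k L π else 1) * shiftWeight (algebraMap k L π) j := by
    unfold shiftWeight
    have h1 := i.isLt
    have h2 := j.isLt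
    rw [Fin.val_add_one_eq_ite, Fin.val_add_one_eq_ite]
    by_cases hi : i + 1 = 0 <;> by_cases hj : j + 1 = 0
    · have h3 : i = j := add_right_cancel (hi.trans hj.symm)
      simp [h3]
    · have h3 := Fin.val_add_one_of_add_one_eq_zero hi
      have h4 : (j : ℕ) < i := by
        have : (j : ℕ) ≠ i := fun h => hj (by rw [Fin.ext h, hi])
        omega
      simp [hi, hj, h4]
    · have h3 := Fin.val_add_one_of_add_one_eq_zero hj
      have h4 : ¬ (j : ℕ) < i := by omega
      simp [hi, hj, h4]
    · simp [hi, hj]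
  have hπ : ∀ p : Prop, ∀ [Decidable p], σ (if p then algebraMap k L π else 1) =
      if p then algebraMap k L π else 1 := by
    intro p _
    split_ifs <;> simp
  simp only [cyclicMatrix, Matrix.of_apply]
  rw [map_mul, apply_inv_pow_val_add_one hσ, hπ, add_sub_add_right_eq_sub, mul_left_comm, hw,
    mul_assoc]

theorem cyclicMatrix_zero_apply (x : Fin r → L) (j : Fin r) : cyclicMatrix σ π x 0 j = x j := by
  have h : (σ⁻¹ ^ ((0 : Fin r) : ℕ)) (x (j - 0)) = x j := by
    rw [Fin.val_zero, pow_zero, sub_zero, AlgEquiv.one_apply]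
  simp only [cyclicMatrix, Matrix.of_apply, h]
  simp

/-- Elements of the cyclic algebra commute with the semilinear shift, so their determinant is fixed
by `σ`. -/
theorem apply_det_of_mem_cyclicAlgebra (hπ : π ≠ 0) {M : Matrix (Fin r) (Fin r) L}
    (hM : M ∈ cyclicAlgebra σ π r) : σ M.det = M.det := by
  let e : Fin r ≃ Fin r := Equiv.addRight 1
  have h1 : Matrix.diagonal (shiftWeight (algebraMap k L π)) *
      (σ.toAlgHom.mapMatrix M).submatrix e e =
      M * Matrix.diagonal (shiftWeight (algebraMap k L π)) := by
    ext i j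
    rw [Matrix.diagonal_mul, Matrix.mul_diagonal]
    exact hM i j
  have h2 := congrArg Matrix.det h1
  rw [Matrix.det_mul, Matrix.det_mul, Matrix.det_submatrix_equiv_self, mul_comm,
    ← AlgHom.map_det] at h2
  refine mul_right_cancel₀ ?_ h2
  rw [Matrix.det_diagonal]
  exact Finset.prod_ne_zero_iff.mpr fun i _ => shiftWeight_ne_zero hπ i

theorem cyclicAlgebra_isCentral [FiniteDimensional k L] [IsGalois k L] (hσ : orderOf σ = r)
    (hgen : ∀ τ : L ≃ₐ[k] L, τ ∈ Subgroup.zpowers σ) (hπ : π ≠ 0) :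
    Algebra.IsCentral k (cyclicAlgebra σ π r) := by
  have hσr : σ ^ r = 1 := hσ ▸ pow_orderOf_eq_one σ
  refine ⟨fun M hM => ?_⟩
  rw [Subalgebra.mem_center_iff] at hM
  obtain ⟨M, hMD⟩ := M
  have hcomm : ∀ N ∈ cyclicAlgebra σ π r, N * M = M * N := fun N hN =>
    congrArg Subtype.val (hM ⟨N, hN⟩)
  have hdiag : ∀ i j, i ≠ j → M i j = 0 := by
    intro i j hij
    by_contra hne
    refine hij ?_
    -- Commuting with the diagonal matrix of the conjugates of x gives σ⁻ⁱ(x) M i j = M i j σ⁻ʲ(x)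
    -- for every x in L.
    have hpow : σ⁻¹ ^ (i : ℕ) = σ⁻¹ ^ (j : ℕ) := by
      ext x
      have h := congrFun (congrFun (hcomm _ (cyclicMatrix_mem hσr (Pi.single 0 x))) i) j
      rw [Matrix.mul_apply, Matrix.mul_apply, Finset.sum_eq_single i, Finset.sum_eq_single j,
        mul_comm] at h
      · simpa [cyclicMatrix, hne] using h
      · intro l _ hl
        have : j - l ≠ 0 := sub_ne_zero.mpr hl.symm
        simp [cyclicMatrix, Pi.single_eq_of_ne this]
      · simp
      · intro l _ hl
        have : l - i ≠ 0 := sub_ne_zero.mpr hl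
        simp [cyclicMatrix, Pi.single_eq_of_ne this]
      · simp
    exact Fin.ext (pow_injOn_Iio_orderOf (x := σ⁻¹) (by simp [hσ]) (by simp [hσ]) hpow)
  -- The shift U itself belongs to the algebra; commuting with it makes the diagonal of M constant.
  have hU : Matrix.of (fun i j : Fin r => if j = i + 1 then shiftWeight (algebraMap k L π) i else 0)
      ∈ cyclicAlgebra σ π r := by
    intro i j
    simp only [Matrix.of_apply, add_left_inj]
    by_cases h : j = i + 1
    · have : ∀ i : Fin r, σ (shiftWeight (algebraMap k L π) i) =
          shiftWeight (algebraMap k L π) i := fun i => by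
        unfold shiftWeight; split_ifs <;> simp
      simp [h, this]
    · simp [h]
  have hstep : ∀ i, M (i + 1) (i + 1) = M i i := by
    intro i
    have h := congrFun (congrFun (hcomm _ hU) i) (i + 1)
    rw [Matrix.mul_apply, Matrix.mul_apply, Finset.sum_eq_single (i + 1), Finset.sum_eq_single i]
      at h
    · simp only [Matrix.of_apply, if_true] at h
      rw [mul_comm] at h
      exact mul_right_cancel₀ (shiftWeight_ne_zero hπ i) h
    · intro l _ hl
      simp [hdiag i l hl.symm]
    · simp
    · intro l _ hl
      simp [hdiag l (i + 1) hl]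
    · simp
  have hconst : ∀ i, M i i = M 0 0 := by
    have : ∀ n : ℕ, ∀ h : n < r, M ⟨n, h⟩ ⟨n, h⟩ = M 0 0 := by
      intro n
      induction n with
      | zero => intro h; rfl
      | succ n ih =>
        intro h
        have h1 := ih (by omega)
        rw [← h1, ← hstep ⟨n, by omega⟩]
        have : (⟨n, by omega⟩ + 1 : Fin r) = ⟨n + 1, h⟩ := by
          apply Fin.ext
          rw [Fin.val_add, Fin.val_one', Nat.add_mod_mod]
          exact Nat.mod_eq_of_lt h
        rw [this]
    exact fun i => this i i.isLt
  have hfix : σ (M 0 0) = M 0 0 := by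
    have h := hMD 0 0
    rw [hstep, mul_comm] at h
    exact mul_right_cancel₀ (shiftWeight_ne_zero hπ 0) h
  have hfixall : ∀ τ : L ≃ₐ[k] L, τ (M 0 0) = M 0 0 := by
    intro τ
    have h1 : σ ∈ MulAction.stabilizer (L ≃ₐ[k] L) (M 0 0) := hfix
    exact (Subgroup.zpowers_le.mpr h1) (hgen τ)
  obtain ⟨c, hc⟩ := (IsGalois.mem_range_algebraMap_iff_fixed (M 0 0)).mpr hfixall
  rw [Algebra.mem_bot]
  refine ⟨c, Subtype.ext ?_⟩
  ext i j
  change algebraMap k (Matrix (Fin r) (Fin r) L) c i j = M i j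
  rw [Matrix.algebraMap_matrix_apply]
  split_ifs with h
  · rw [hc, ← h, hconst i]
  · rw [hdiag i j h]

end CyclicAlgebra

/-! ### Norms of entries and determinants in a cyclic algebra -/

section NormedCyclicAlgebra

variable {k L : Type*} [Field k] [NormedField L] [Algebra k L]
  {σ : L ≃ₐ[k] L} {π : k} {r : ℕ} [NeZero r]

/-- Here ρ plays the role of the norm of U. Taking norms in the defining relation moves one step
along a diagonal, and ρ ^ r = ‖π‖ absorbs the weight at the wrap-around. -/
theorem norm_apply_of_mem_cyclicAlgebra (hπ : π ≠ 0) (hσ : ∀ x, ‖σ x‖ = ‖x‖) {ρ : ℝ} (hρ : 0 < ρ)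
    (hρπ : ρ ^ r = ‖algebraMap k L π‖) {M : Matrix (Fin r) (Fin r) L}
    (hM : M ∈ cyclicAlgebra σ π r) (i j : Fin r) :
    ‖M i j‖ * ρ ^ (j : ℕ) = ‖M 0 (j - i)‖ * ρ ^ ((j - i : Fin r) : ℕ) * ρ ^ (i : ℕ) := by
  have hs : ∀ i : Fin r, ρ ^ ((i + 1 : Fin r) : ℕ) * ‖shiftWeight (algebraMap k L π) i‖ =
      ρ ^ (i : ℕ) * ρ := fun i => by
    rw [Fin.val_add_one_eq_ite, shiftWeight, ← pow_succ]
    split_ifs with h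
    · rw [pow_zero, one_mul, Fin.val_add_one_of_add_one_eq_zero h, hρπ]
    · rw [norm_one, mul_one]
  have hu : ∀ i : Fin r, 0 < ‖shiftWeight (algebraMap k L π) i‖ := fun i =>
    norm_pos_iff.mpr (shiftWeight_ne_zero hπ i)
  have hT : ∀ i j : Fin r, ‖M (i + 1) (j + 1)‖ * ρ ^ ((j + 1 : Fin r) : ℕ) * ρ ^ (i : ℕ) =
      ‖M i j‖ * ρ ^ (j : ℕ) * ρ ^ ((i + 1 : Fin r) : ℕ) := fun i j => by
    have h := congrArg norm (hM i j)
    rw [norm_mul, norm_mul, hσ] at h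
    have hne : ‖shiftWeight (algebraMap k L π) i‖ * ‖shiftWeight (algebraMap k L π) j‖ * ρ ≠ 0 :=
      (mul_pos (mul_pos (hu i) (hu j)) hρ).ne'
    refine mul_right_cancel₀ hne ?_
    calc _ = (‖shiftWeight (algebraMap k L π) i‖ * ‖M (i + 1) (j + 1)‖) *
          (ρ ^ ((j + 1 : Fin r) : ℕ) * ‖shiftWeight (algebraMap k L π) j‖) *
          (ρ ^ (i : ℕ) * ρ) := by ring
      _ = (‖M i j‖ * ‖shiftWeight (algebraMap k L π) j‖) * (ρ ^ (j : ℕ) * ρ) *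
          (ρ ^ ((i + 1 : Fin r) : ℕ) * ‖shiftWeight (algebraMap k L π) i‖) := by
        rw [h, hs, hs]
      _ = _ := by ring
  have key : ∀ n : ℕ, ∀ h : n < r, ∀ j : Fin r, ‖M ⟨n, h⟩ j‖ * ρ ^ (j : ℕ) =
      ‖M 0 (j - ⟨n, h⟩)‖ * ρ ^ ((j - ⟨n, h⟩ : Fin r) : ℕ) * ρ ^ n := by
    intro n
    induction n with
    | zero =>
      intro h j
      have : (⟨0, h⟩ : Fin r) = 0 := rfl
      rw [this, sub_zero, pow_zero, mul_one]
    | succ n ih =>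
      intro h j
      have hn : (⟨n, by omega⟩ + 1 : Fin r) = ⟨n + 1, h⟩ := by
        apply Fin.ext
        rw [Fin.val_add, Fin.val_one', Nat.add_mod_mod]
        exact Nat.mod_eq_of_lt h
      have h1 := hT ⟨n, by omega⟩ (j - 1)
      rw [ih (by omega) (j - 1), sub_add_cancel, hn, sub_sub, add_comm 1, hn] at h1
      have hne : ρ ^ n ≠ 0 := (pow_pos hρ n).ne'
      refine mul_right_cancel₀ hne (h1.trans ?_)
      ring
  exact key i i.isLt j

theorem eq_zero_of_mem_cyclicAlgebra_of_row_eq_zero (hπ : π ≠ 0) (hσ : ∀ x, ‖σ x‖ = ‖x‖) {ρ : ℝ}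
    (hρ : 0 < ρ) (hρπ : ρ ^ r = ‖algebraMap k L π‖) {M : Matrix (Fin r) (Fin r) L}
    (hM : M ∈ cyclicAlgebra σ π r) (h : ∀ j, M 0 j = 0) : M = 0 := by
  ext i j
  have h1 := norm_apply_of_mem_cyclicAlgebra hπ hσ hρ hρπ hM i j
  rw [h, norm_zero, zero_mul, zero_mul] at h1
  simpa [hρ.ne'] using h1

/-- Taking the first row is a bijection onto Lʳ: injective by the norm relation, surjective by
`cyclicMatrix`. -/
theorem finrank_cyclicAlgebra [FiniteDimensional k L] (hπ : π ≠ 0) (hσ : ∀ x, ‖σ x‖ = ‖x‖) {ρ : ℝ}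
    (hρ : 0 < ρ) (hρπ : ρ ^ r = ‖algebraMap k L π‖) (hσr : σ ^ r = 1) :
    Module.finrank k (cyclicAlgebra σ π r) = r * Module.finrank k L := by
  let row : cyclicAlgebra σ π r →ₗ[k] (Fin r → L) :=
    { toFun := fun M => (M : Matrix (Fin r) (Fin r) L) 0
      map_add' := fun _ _ => rfl
      map_smul' := fun _ _ => rfl }
  have hbij : Function.Bijective row := by
    refine ⟨(injective_iff_map_eq_zero row).mpr fun M h => ?_, fun x => ?_⟩
    · exact Subtype.ext (eq_zero_of_mem_cyclicAlgebra_of_row_eq_zero hπ hσ hρ hρπ M.2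
        fun j => congrFun h j)
    · exact ⟨⟨cyclicMatrix σ π x, cyclicMatrix_mem hσr x⟩,
        funext fun j => cyclicMatrix_zero_apply x j⟩
  rw [(LinearEquiv.ofBijective row hbij).finrank_eq, Module.finrank_pi_fintype]
  simp

variable [IsUltrametricDist L]

/-- The determinant of an element of the cyclic algebra has the absolute value of the dominant
term of its first row. -/
theorem exists_norm_det_eq (hπ : π ≠ 0) (hσ : ∀ x, ‖σ x‖ = ‖x‖) {ρ : ℝ} (hρ : 0 < ρ) (hρ1 : ρ ≠ 1)
    (hρπ : ρ ^ r = ‖algebraMap k L π‖)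
    (hval : ∀ x : L, x ≠ 0 → ∃ m : ℤ, ‖x‖ = ‖algebraMap k L π‖ ^ m)
    {M : Matrix (Fin r) (Fin r) L} (hM : M ∈ cyclicAlgebra σ π r) :
    ∃ c : Fin r, ‖M.det‖ = (‖M 0 c‖ * ρ ^ (c : ℕ)) ^ r ∧
      ∀ j : Fin r, ‖M 0 j‖ * ρ ^ (j : ℕ) ≤ ‖M 0 c‖ * ρ ^ (c : ℕ) := by
  have hT := norm_apply_of_mem_cyclicAlgebra hπ hσ hρ hρπ hM
  obtain ⟨c, hc⟩ := Finite.exists_max fun j : Fin r => ‖M 0 j‖ * ρ ^ (j : ℕ)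
  refine ⟨c, ?_, hc⟩
  by_cases h0 : M 0 c = 0
  · have hrow : ∀ j, M 0 j = 0 := fun j => by
      have := hc j
      rw [h0, norm_zero, zero_mul] at this
      have h2 := nonpos_of_mul_nonpos_left this (pow_pos hρ _)
      exact norm_le_zero_iff.mp h2
    rw [Matrix.det_eq_zero_of_row_eq_zero 0 hrow, h0, norm_zero, zero_mul,
      zero_pow (NeZero.ne r)]
  · refine Matrix.norm_det_eq_of_dominant M (fun j => ‖M 0 j‖ * ρ ^ (j : ℕ))
      (fun i => ρ ^ (i : ℕ)) (fun i => pow_pos hρ _) hT c fun i hi => ?_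
    refine (hc i).lt_of_ne fun heq => hi ?_
    have hi0 : M 0 i ≠ 0 := by
      intro h
      rw [h, norm_zero, zero_mul, eq_comm] at heq
      exact (mul_pos (norm_pos_iff.mpr h0) (pow_pos hρ _)).ne' heq
    obtain ⟨a, ha⟩ := hval _ hi0
    obtain ⟨b, hb⟩ := hval _ h0
    -- Equality of the two values reads ρ ^ (r a + i) = ρ ^ (r b + c), whence i and c agree modulo
    -- r.
    rw [ha, hb, ← hρπ, ← zpow_natCast, ← zpow_natCast, ← zpow_natCast, ← zpow_mul, ← zpow_mul,
      ← zpow_add₀ hρ.ne', ← zpow_add₀ hρ.ne'] at heq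
    have h1 := zpow_right_injective₀ hρ hρ1 heq
    have h2 := congrArg (· % (r : ℤ)) h1
    simp only [Int.mul_add_emod_self_left] at h2
    rw [← Int.natCast_mod, ← Int.natCast_mod, Nat.mod_eq_of_lt i.isLt, Nat.mod_eq_of_lt c.isLt]
      at h2
    exact Fin.ext (by exact_mod_cast h2)

theorem det_eq_zero_iff_of_mem_cyclicAlgebra (hπ : π ≠ 0) (hσ : ∀ x, ‖σ x‖ = ‖x‖) {ρ : ℝ}
    (hρ : 0 < ρ) (hρ1 : ρ ≠ 1) (hρπ : ρ ^ r = ‖algebraMap k L π‖)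
    (hval : ∀ x : L, x ≠ 0 → ∃ m : ℤ, ‖x‖ = ‖algebraMap k L π‖ ^ m)
    {M : Matrix (Fin r) (Fin r) L} (hM : M ∈ cyclicAlgebra σ π r) : M.det = 0 ↔ M = 0 := by
  refine ⟨fun h => ?_, fun h => by rw [h, Matrix.det_zero]⟩
  obtain ⟨c, hc, hle⟩ := exists_norm_det_eq hπ hσ hρ hρ1 hρπ hval hM
  rw [h, norm_zero, eq_comm, pow_eq_zero_iff (NeZero.ne r)] at hc
  refine eq_zero_of_mem_cyclicAlgebra_of_row_eq_zero hπ hσ hρ hρπ hM fun j => ?_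
  have := hle j
  rw [hc] at this
  exact norm_le_zero_iff.mp (nonpos_of_mul_nonpos_left this (pow_pos hρ _))

/-- The norm of the determinant is the r-th power of a weighted sup norm of the first row, which is
ultrametric. -/
theorem norm_det_add_le (hπ : π ≠ 0) (hσ : ∀ x, ‖σ x‖ = ‖x‖) {ρ : ℝ}
    (hρ : 0 < ρ) (hρ1 : ρ ≠ 1) (hρπ : ρ ^ r = ‖algebraMap k L π‖)
    (hval : ∀ x : L, x ≠ 0 → ∃ m : ℤ, ‖x‖ = ‖algebraMap k L π‖ ^ m)
    {M N : Matrix (Fin r) (Fin r) L} (hM : M ∈ cyclicAlgebra σ π r)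
    (hN : N ∈ cyclicAlgebra σ π r) : ‖(M + N).det‖ ≤ max ‖M.det‖ ‖N.det‖ := by
  obtain ⟨a, ha, hale⟩ := exists_norm_det_eq hπ hσ hρ hρ1 hρπ hval hM
  obtain ⟨b, hb, hble⟩ := exists_norm_det_eq hπ hσ hρ hρ1 hρπ hval hN
  obtain ⟨c, hc, -⟩ := exists_norm_det_eq hπ hσ hρ hρ1 hρπ hval (add_mem hM hN)
  rw [hc, Matrix.add_apply]
  have hpos := pow_pos hρ (c : ℕ)
  rcases le_total ‖M 0 c‖ ‖N 0 c‖ with h | h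
  · refine le_max_of_le_right ?_
    rw [hb]
    refine pow_le_pow_left₀ (by positivity) (le_trans ?_ (hble c)) r
    exact mul_le_mul_of_nonneg_right
      ((IsUltrametricDist.norm_add_le_max _ _).trans (max_le h le_rfl)) hpos.le
  · refine le_max_of_le_left ?_
    rw [ha]
    refine pow_le_pow_left₀ (by positivity) (le_trans ?_ (hale c)) r
    exact mul_le_mul_of_nonneg_right
      ((IsUltrametricDist.norm_add_le_max _ _).trans (max_le le_rfl h)) hpos.le

end NormedCyclicAlgebra

/-! ### Unramified extensions of local fields -/

section ResidueField

open IsLocalRing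

/-- The valuation ring of a non-archimedean normed field. -/
noncomputable abbrev normInteger (K : Type*) [NormedField K] [IsUltrametricDist K] :
    ValuationSubring K :=
  (NormedField.valuation (K := K)).valuationSubring

section

variable {K : Type*} [NormedField K] [IsUltrametricDist K]

theorem mem_normInteger {x : K} : x ∈ normInteger K ↔ ‖x‖ ≤ 1 := by
  rw [Valuation.mem_valuationSubring_iff, NormedField.valuation_apply, ← NNReal.coe_le_coe,
    coe_nnnorm, NNReal.coe_one]

theorem normInteger.isUnit_iff (x : normInteger K) : IsUnit x ↔ ‖(x : K)‖ = 1 := by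
  have h := (Valuation.integer.integers (NormedField.valuation (K := K))).isUnit_iff_valuation_eq_one
    (x := x)
  refine h.trans ?_
  change ‖(x : K)‖₊ = 1 ↔ _
  rw [← NNReal.coe_inj, coe_nnnorm, NNReal.coe_one]

theorem normInteger.residue_eq_zero_iff (x : normInteger K) :
    residue (normInteger K) x = 0 ↔ ‖(x : K)‖ < 1 := by
  rw [IsLocalRing.residue_eq_zero_iff, mem_maximalIdeal, mem_nonunits_iff, normInteger.isUnit_iff]
  exact ⟨fun h => (mem_normInteger.mp x.2).lt_of_ne h, fun h => h.ne⟩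

end

/-! ### Discreteness and finiteness for local fields -/

section Local

variable (k : Type*) [NontriviallyNormedField k] [IsUltrametricDist k] [LocallyCompactSpace k]

open scoped NormedField Valued in
-- The valuation ring is the closed unit ball, which is compact; compactness forces both properties.
theorem normInteger.isDiscreteValuationRing_and_finite_residueField :
    IsDiscreteValuationRing (normInteger k) ∧ Finite (ResidueField (normInteger k)) := by
  have : ProperSpace k := ProperSpace.of_locallyCompactSpace k
  have hc : CompactSpace 𝒪[k] := by
    refine isCompact_iff_compactSpace.mp ?_
    convert isCompact_closedBall (0 : k) 1
    ext x
    rw [mem_closedBall_zero_iff]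
    exact Valued.integer.mem_iff
  let : (Valued.v : Valuation k NNReal).RankOne :=
    inferInstanceAs (NormedField.valuation (K := k)).RankOne
  exact (Valued.integer.compactSpace_iff_completeSpace_and_isDiscreteValuationRing_and_finite_residueField.mp
    hc).2

theorem exists_uniformizer :
    ∃ π : k, π ≠ 0 ∧ ‖π‖ < 1 ∧ ∀ x : k, x ≠ 0 → ∃ m : ℤ, ‖x‖ = ‖π‖ ^ m := by
  have := (normInteger.isDiscreteValuationRing_and_finite_residueField k).1
  obtain ⟨π, hπ⟩ := IsDiscreteValuationRing.exists_irreducible (normInteger k)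
  have hle_one : ∀ x : k, x ≠ 0 → ‖x‖ ≤ 1 → ∃ m : ℤ, ‖x‖ = ‖(π : k)‖ ^ m := by
    intro x hx hx1
    obtain ⟨n, w, h⟩ := IsDiscreteValuationRing.eq_unit_mul_pow_irreducible
      (x := (⟨x, mem_normInteger.mpr hx1⟩ : normInteger k))
      (fun h => hx (congrArg Subtype.val h)) hπ
    have h1 : x = (w : normInteger k) * (π : k) ^ n := congrArg Subtype.val h
    refine ⟨n, ?_⟩
    rw [h1, norm_mul, norm_pow, (normInteger.isUnit_iff _).mp w.isUnit, one_mul, zpow_natCast]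
  refine ⟨π, fun h => hπ.ne_zero (Subtype.ext h), ?_, fun x hx => ?_⟩
  · exact (mem_normInteger.mp π.2).lt_of_ne fun h =>
      hπ.not_isUnit ((normInteger.isUnit_iff π).mpr h)
  · rcases le_total ‖x‖ 1 with h | h
    · exact hle_one x hx h
    · obtain ⟨m, hm⟩ := hle_one x⁻¹ (inv_ne_zero hx) (by rw [norm_inv]; exact inv_le_one_of_one_le₀ h)
      exact ⟨-m, by rw [zpow_neg, ← hm, norm_inv, inv_inv]⟩

end Local

/-! ### Residue fields of an extension -/

section Extension

variable {k L : Type*} [NormedField k] [IsUltrametricDist k] [NormedField L]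
  [IsUltrametricDist L] [NormedAlgebra k L]

/-- Makes the residue field of L an algebra over that of k. -/
instance NormedField.valuation_hasExtension :
    (NormedField.valuation (K := k)).HasExtension (NormedField.valuation (K := L)) where
  val_isEquiv_comap := by
    intro x y
    simp [nnnorm_algebraMap']

/-- A family of integers of `L` with linearly independent residues is orthonormal over `k`. -/
theorem norm_sum_smul_of_linearIndependent_residue {ι : Type*} [Fintype ι] (y : ι → normInteger L)
    (hy : LinearIndependent (ResidueField (normInteger k))
      fun i => residue (normInteger L) (y i))
    (c : ι → k) (j : ι) (hj : ∀ i, ‖c i‖ ≤ ‖c j‖) : ‖∑ i, c i • (y i : L)‖ = ‖c j‖ := by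
  by_cases h0 : c j = 0
  · have : ∀ i, c i = 0 := fun i => norm_le_zero_iff.mp ((hj i).trans (by rw [h0, norm_zero]))
    simp [this]
  have ha : ∀ i, (c j)⁻¹ * c i ∈ normInteger k := fun i => by
    rw [mem_normInteger, norm_mul, norm_inv]
    exact inv_mul_le_one_of_le₀ (hj i) (norm_nonneg _)
  let a : ι → normInteger k := fun i => ⟨_, ha i⟩
  let z : normInteger L := ∑ i, algebraMap (normInteger k) (normInteger L) (a i) * y i
  have hz : (z : L) = (c j)⁻¹ • ∑ i, c i • (y i : L) := by
    rw [Finset.smul_sum]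
    change (normInteger L).subtype z = _
    rw [map_sum]
    refine Finset.sum_congr rfl fun i _ => ?_
    rw [smul_smul, Algebra.smul_def]
    rfl
  -- After division by the largest coefficient, the residue of z is a combination of independent
  -- vectors with one coefficient equal to 1.
  have hres : residue (normInteger L) z ≠ 0 := by
    intro h
    rw [map_sum] at h
    have h1 := Fintype.linearIndependent_iff.mp hy (fun i => residue (normInteger k) (a i)) (by
      rw [← h]
      refine Finset.sum_congr rfl fun i _ => ?_
      rw [map_mul, Algebra.smul_def]
      rfl) j
    have h2 : a j = 1 := Subtype.ext (inv_mul_cancel₀ h0)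
    rw [h2, map_one] at h1
    exact one_ne_zero h1
  rw [Ne, normInteger.residue_eq_zero_iff, not_lt] at hres
  have h1 : ‖(z : L)‖ = 1 := le_antisymm (mem_normInteger.mp z.2) hres
  rw [hz, norm_smul, norm_inv, inv_mul_eq_one₀ (norm_ne_zero_iff.mpr h0)] at h1
  exact h1.symm

theorem linearIndependent_of_residue {ι : Type*} [Fintype ι] (y : ι → normInteger L)
    (hy : LinearIndependent (ResidueField (normInteger k))
      fun i => residue (normInteger L) (y i)) : LinearIndependent k fun i => (y i : L) := by
  rw [Fintype.linearIndependent_iff]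
  intro c hc i
  have : Nonempty ι := ⟨i⟩
  obtain ⟨j, hj⟩ := Finite.exists_max fun i => ‖c i‖
  have h := norm_sum_smul_of_linearIndependent_residue y hy c j hj
  rw [hc, norm_zero] at h
  exact norm_le_zero_iff.mp ((hj i).trans h.symm.le)

variable [FiniteDimensional k L]

/-- Lifts of independent residues stay independent over k. -/
theorem rank_residueField_le : Module.rank (ResidueField (normInteger k))
    (ResidueField (normInteger L)) ≤ (Module.finrank k L : ℕ) := by
  refine rank_le fun s hs => ?_
  choose y hy using fun x : s => residue_surjective (R := normInteger L) x
  have h : LinearIndependent k fun i => (y i : L) := by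
    apply linearIndependent_of_residue
    simp_rw [hy]
    exact hs
  simpa using h.fintype_card_le_finrank

instance finiteDimensional_residueField :
    FiniteDimensional (ResidueField (normInteger k)) (ResidueField (normInteger L)) :=
  Module.rank_lt_aleph0_iff.mp (rank_residueField_le.trans_lt (Cardinal.natCast_lt_aleph0))

theorem finrank_residueField_le : Module.finrank (ResidueField (normInteger k))
    (ResidueField (normInteger L)) ≤ Module.finrank k L :=
  Module.finrank_le_of_rank_le rank_residueField_le

/-- If the residue degree is the full degree, the norm takes the same values on `L` as on `k`. -/
theorem exists_norm_eq_of_finrank_residueField_eq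
    (h : Module.finrank (ResidueField (normInteger k)) (ResidueField (normInteger L)) =
      Module.finrank k L) (x : L) : ∃ c : k, ‖x‖ = ‖c‖ := by
  let b := Module.finBasis (ResidueField (normInteger k)) (ResidueField (normInteger L))
  choose y hy using fun i => residue_surjective (R := normInteger L) (b i)
  have hb : LinearIndependent (ResidueField (normInteger k))
      fun i => residue (normInteger L) (y i) := by
    simp_rw [hy]
    exact b.linearIndependent
  have hli := linearIndependent_of_residue (k := k) y hb
  have : Nonempty (Fin (Module.finrank (ResidueField (normInteger k))
    (ResidueField (normInteger L)))) := ⟨⟨0, Module.finrank_pos⟩⟩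
  -- B is an orthonormal basis of L, so the norm of x is that of its largest coordinate.
  let B := basisOfLinearIndependentOfCardEqFinrank hli (by simpa using h)
  obtain ⟨j, hj⟩ := Finite.exists_max fun i => ‖B.repr x i‖
  refine ⟨B.repr x j, ?_⟩
  rw [← norm_sum_smul_of_linearIndependent_residue y hb (fun i => B.repr x i) j hj]
  congr 1
  conv_lhs => rw [← B.sum_repr x]
  simp [B]

theorem exists_residue_algEquiv (g : L ≃ₐ[k] L) (hg : ∀ x, ‖g x‖ = ‖x‖) :
    ∃ γ : ResidueField (normInteger L) ≃ₐ[ResidueField (normInteger k)]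
      ResidueField (normInteger L), ∀ x y : normInteger L, (y : L) = g x →
        γ (residue _ x) = residue _ y := by
  let φ : normInteger L →+* normInteger L :=
    (g : L →+* L).restrict (normInteger L) (normInteger L) fun x hx => by
      rw [mem_normInteger] at hx ⊢
      exact (hg x).le.trans hx
  have hφ : ∀ x, (φ x : L) = g x := fun _ => rfl
  have : IsLocalHom φ := ⟨fun x hx => by
    rw [normInteger.isUnit_iff, hφ, hg] at hx
    rwa [normInteger.isUnit_iff]⟩
  let ψ : ResidueField (normInteger L) →ₐ[ResidueField (normInteger k)]
      ResidueField (normInteger L) :=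
    { ResidueField.map φ with
      commutes' := fun c => by
        obtain ⟨c, rfl⟩ := residue_surjective c
        change ResidueField.map φ (residue _ (algebraMap (normInteger k) (normInteger L) c)) =
          residue _ (algebraMap (normInteger k) (normInteger L) c)
        rw [ResidueField.map_residue]
        congr 1
        exact Subtype.ext (g.commutes (c : k)) }
  refine ⟨AlgEquiv.ofBijective ψ (Algebra.IsAlgebraic.algHom_bijective ψ), fun x y hxy => ?_⟩
  have : φ x = y := Subtype.ext hxy.symm
  rw [← this]
  exact ResidueField.map_residue φ x

/-- Roots of unity of order prime to the residue characteristic are determined by their residue. -/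
theorem eq_of_residue_eq_of_pow_eq_one {n : ℕ} (hn : (n : ResidueField (normInteger L)) ≠ 0)
    {x y : normInteger L} (hx : x ^ n = 1) (hy : y ^ n = 1)
    (h : residue (normInteger L) x = residue (normInteger L) y) : x = y := by
  have hn0 : n ≠ 0 := by
    rintro rfl
    simp at hn
  -- If the first factor vanished, its residue n ȳ ^ (n - 1) would be zero, although n and ȳ are
  -- nonzero.
  have h0 : (∑ i ∈ Finset.range n, x ^ i * y ^ (n - 1 - i)) * (x - y) = 0 := by
    rw [Commute.geom_sum₂_mul (Commute.all x y), hx, hy, sub_self]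
  rcases mul_eq_zero.mp h0 with h1 | h1
  · exfalso
    have h2 := congrArg (residue (normInteger L)) h1
    rw [map_sum, map_zero] at h2
    have h3 : ∀ i ∈ Finset.range n, residue (normInteger L) (x ^ i * y ^ (n - 1 - i)) =
        residue (normInteger L) y ^ (n - 1) := fun i hi => by
      rw [map_mul, map_pow, map_pow, h, ← pow_add]
      congr 1
      have := Finset.mem_range.mp hi
      omega
    rw [Finset.sum_congr rfl h3, Finset.sum_const, Finset.card_range, nsmul_eq_mul] at h2
    rcases mul_eq_zero.mp h2 with h4 | h4
    · exact hn h4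
    · have h5 := congrArg (residue (normInteger L)) hy
      rw [map_pow, map_one, eq_zero_of_pow_eq_zero h4, zero_pow hn0] at h5
      exact zero_ne_one h5
  · exact sub_eq_zero.mp h1

end Extension

/-! ### The unramified extension generated by roots of unity -/

section Cyclotomic

variable {k L : Type*} [NontriviallyNormedField k] [IsUltrametricDist k] [LocallyCompactSpace k]
  [NormedField L] [IsUltrametricDist L] [NormedAlgebra k L] {r : ℕ}

/-- Let `q` be the cardinality of the residue field of `k`. The extension of `k` generated by
the roots of unity of order `q ^ r - 1` has degree `r`, its norm takes the same values as that of
`k`, and its Galois group is generated by a lift of the Frobenius automorphism. -/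
theorem exists_frobenius_of_isCyclotomicExtension (hr : 0 < r)
    [NeZero (Nat.card (ResidueField (normInteger k)) ^ r - 1)]
    [IsCyclotomicExtension {Nat.card (ResidueField (normInteger k)) ^ r - 1} k L]
    [FiniteDimensional k L] [IsGalois k L]
    (hiso : ∀ (g : L ≃ₐ[k] L) (x : L), ‖g x‖ = ‖x‖) :
    Module.finrank k L = r ∧ (∃ σ : L ≃ₐ[k] L, orderOf σ = r) ∧ ∀ x : L, ∃ c : k, ‖x‖ = ‖c‖ := by
  have hfin := (normInteger.isDiscreteValuationRing_and_finite_residueField k).2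
  let κ := ResidueField (normInteger k)
  let l := ResidueField (normInteger L)
  have : Finite κ := hfin
  have : Fintype κ := Fintype.ofFinite κ
  have : Finite l := Module.finite_of_finite κ
  have : Fintype l := Fintype.ofFinite l
  set q := Nat.card (ResidueField (normInteger k)) with hq
  have hqc : q = Fintype.card κ := Nat.card_eq_fintype_card
  set n := q ^ r - 1 with hn
  have hq1 : 1 < q := by rw [hqc]; exact Fintype.one_lt_card
  have hn1 : n + 1 = q ^ r := Nat.sub_add_cancel (Nat.one_le_pow _ _ (by omega))
  -- In the residue field n = q ^ r - 1 becomes -1.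
  have hnl : (n : l) ≠ 0 := by
    have h1 : ((n + 1 : ℕ) : l) = 0 := by
      rw [hn1, Nat.cast_pow, ← map_natCast (algebraMap κ l) q, hqc,
        FiniteField.cast_card_eq_zero, map_zero, zero_pow hr.ne']
    intro h
    rw [Nat.cast_add, h, zero_add, Nat.cast_one] at h1
    exact one_ne_zero h1
  have hζ := IsCyclotomicExtension.zeta_spec n k L
  set ζ := IsCyclotomicExtension.zeta n k L
  have hmem : ∀ x : L, x ^ n = 1 → x ∈ normInteger L := fun x hx => by
    rw [mem_normInteger]
    exact ((pow_eq_one_iff_of_nonneg (norm_nonneg x) (NeZero.ne n)).mp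
      (by rw [← norm_pow, hx, norm_one])).le
  have hgζ : ∀ g : L ≃ₐ[k] L, g ζ ^ n = 1 := fun g => by rw [← map_pow, hζ.pow_eq_one, map_one]
  let Z : (L ≃ₐ[k] L) → normInteger L := fun g => ⟨g ζ, hmem _ (hgζ g)⟩
  have hZ : ∀ g, Z g ^ n = 1 := fun g => Subtype.ext (hgζ g)
  have hext : ∀ g h : L ≃ₐ[k] L, residue _ (Z g) = residue _ (Z h) → g = h := by
    intro g h hgh
    have h1 : g ζ = h ζ := congrArg Subtype.val (eq_of_residue_eq_of_pow_eq_one hnl (hZ g) (hZ h) hgh)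
    apply AlgEquiv.coe_toAlgHom_injective
    exact (hζ.powerBasis k).algHom_ext (by simpa using h1)
  choose γ hγ using fun g : L ≃ₐ[k] L => exists_residue_algEquiv g (hiso g)
  have hγinj : Function.Injective γ := by
    intro g h hgh
    apply hext
    rw [← hγ g (Z 1) (Z g) rfl, ← hγ h (Z 1) (Z h) rfl, hgh]
  -- The Galois group injects into that of the residue extension, whose order is at most [L : k];
  -- hence the two groups and the two degrees agree.
  have hcard : Nat.card (l ≃ₐ[κ] l) ≤ Nat.card (L ≃ₐ[k] L) := by
    rw [IsGalois.card_aut_eq_finrank, IsGalois.card_aut_eq_finrank]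
    exact finrank_residueField_le
  have hγbij : Function.Bijective γ := hγinj.bijective_of_nat_card_le hcard
  have hdeg : Module.finrank κ l = Module.finrank k L := by
    rw [← IsGalois.card_aut_eq_finrank, ← IsGalois.card_aut_eq_finrank]
    exact (Nat.card_congr (Equiv.ofBijective γ hγbij)).symm
  obtain ⟨σ, hσ⟩ := hγbij.2 (FiniteField.frobeniusAlgEquivOfAlgebraic κ l)
  have hσ1 : ∀ x y : normInteger L, (y : L) = σ x → residue _ x ^ q = residue _ y := by
    intro x y hxy
    rw [← hγ σ x y hxy, hσ, hqc]
    rfl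
  have hσm : ∀ m : ℕ, ∀ x y : normInteger L, (y : L) = (σ ^ m) x →
      residue _ x ^ q ^ m = residue _ y := by
    intro m
    induction m with
    | zero =>
      intro x y hxy
      have : y = x := Subtype.ext hxy
      rw [this, pow_zero, pow_one]
    | succ m ih =>
      intro x y hxy
      have hmem' : (σ ^ m) (x : L) ∈ normInteger L := by
        rw [mem_normInteger, hiso]
        exact mem_normInteger.mp x.2
      rw [pow_succ, pow_mul, ih x ⟨_, hmem'⟩ rfl]
      refine hσ1 _ _ ?_
      rw [hxy, pow_succ', AlgEquiv.mul_apply]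
  have hζn : residue (normInteger L) (Z 1) ^ n = 1 := by
    rw [← map_pow, hZ, map_one]
  -- On residues σ ^ r raises to the power q ^ r = n + 1, which fixes the residue of ζ.
  have hσr : σ ^ r = 1 := by
    apply hext
    rw [← hσm r (Z 1) (Z (σ ^ r)) rfl, ← hn1, pow_succ, hζn, one_mul]
  have horder : Module.finrank κ l ∣ orderOf σ := by
    rw [← FiniteField.orderOf_frobeniusAlgEquivOfAlgebraic κ l]
    apply orderOf_dvd_of_pow_eq_one
    ext x
    obtain ⟨x, rfl⟩ := residue_surjective x
    rw [AlgEquiv.coe_pow, FiniteField.coe_frobeniusAlgEquivOfAlgebraic_iterate, ← hqc]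
    exact hσm (orderOf σ) x x (by rw [pow_orderOf_eq_one, AlgEquiv.one_apply])
  have hord : orderOf (residue (normInteger L) (Z 1)) = n := by
    refine Nat.dvd_antisymm (orderOf_dvd_of_pow_eq_one hζn) ?_
    apply hζ.dvd_of_pow_eq_one
    have h1 : Z 1 ^ orderOf (residue (normInteger L) (Z 1)) = 1 := by
      refine eq_of_residue_eq_of_pow_eq_one hnl ?_ (one_pow n) ?_
      · rw [← pow_mul, mul_comm, pow_mul, hZ, one_pow]
      · rw [map_pow, pow_orderOf_eq_one, map_one]
    exact congrArg Subtype.val h1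
  -- The residue of ζ still has order q ^ r - 1, so the residue field of L has at least q ^ r
  -- elements.
  have hle : r ≤ Module.finrank κ l := by
    have h0 : residue (normInteger L) (Z 1) ≠ 0 := by
      intro h
      rw [h, zero_pow (NeZero.ne n)] at hζn
      exact zero_ne_one hζn
    have h1 : n ≤ Fintype.card l - 1 := by
      rw [← hord]
      exact Nat.le_of_dvd (Nat.sub_pos_of_lt Fintype.one_lt_card)
        (orderOf_dvd_of_pow_eq_one (FiniteField.pow_card_sub_one_eq_one _ h0))
    have h2 : Fintype.card l = q ^ Module.finrank κ l := by
      rw [hqc]; exact Module.card_eq_pow_finrank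
    have h3 : q ^ r ≤ q ^ Module.finrank κ l := by
      rw [← h2, ← hn1]
      have : 0 < Fintype.card l := Fintype.card_pos
      omega
    exact (Nat.pow_le_pow_iff_right hq1).mp h3
  have hσdvd : orderOf σ ∣ r := orderOf_dvd_of_pow_eq_one hσr
  have hf : Module.finrank κ l = r :=
    le_antisymm (Nat.le_of_dvd hr (horder.trans hσdvd)) hle
  exact ⟨hdeg ▸ hf, ⟨σ, Nat.dvd_antisymm hσdvd (hf ▸ horder)⟩,
    exists_norm_eq_of_finrank_residueField_eq hdeg⟩

end Cyclotomic

/-- Unramified extensions of every degree exist, and they are cyclic. -/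
theorem exists_unramified_cyclic_extension (k : Type u) [NontriviallyNormedField k]
    [IsUltrametricDist k] [LocallyCompactSpace k] {r : ℕ} (hr : 0 < r) :
    ∃ (L : Type u) (_ : NormedField L) (_ : NormedAlgebra k L),
      IsUltrametricDist L ∧ FiniteDimensional k L ∧ IsGalois k L ∧ Module.finrank k L = r ∧
      ∃ σ : L ≃ₐ[k] L, orderOf σ = r ∧ (∀ x, ‖σ x‖ = ‖x‖) ∧ ∀ x : L, ∃ c : k, ‖x‖ = ‖c‖ := by
  have hfin := (normInteger.isDiscreteValuationRing_and_finite_residueField k).2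
  have : Fintype (ResidueField (normInteger k)) := Fintype.ofFinite _
  have : ProperSpace k := ProperSpace.of_locallyCompactSpace k
  set q := Nat.card (ResidueField (normInteger k)) with hq
  have hqc : q = Fintype.card (ResidueField (normInteger k)) := Nat.card_eq_fintype_card
  have hq1 : 1 < q := by rw [hqc]; exact Fintype.one_lt_card
  have hn1 : q ^ r - 1 + 1 = q ^ r := Nat.sub_add_cancel (Nat.one_le_pow _ _ (by omega))
  have hn0 : NeZero (q ^ r - 1) := ⟨by
    have := Nat.one_lt_pow hr.ne' hq1
    omega⟩
  -- In positive characteristic too, q ^ r - 1 is nonzero in k, since it reduces to -1.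
  have hnk : NeZero ((q ^ r - 1 : ℕ) : k) := ⟨fun h => by
    have h1 : ((q ^ r - 1 : ℕ) : normInteger k) = 0 := Subtype.ext (by push_cast; exact h)
    have h2 := congrArg (residue (normInteger k)) h1
    rw [map_natCast, map_zero] at h2
    have h3 : ((q ^ r - 1 + 1 : ℕ) : ResidueField (normInteger k)) = 0 := by
      rw [hn1, Nat.cast_pow, hqc, FiniteField.cast_card_eq_zero, zero_pow hr.ne']
    rw [Nat.cast_add, h2, zero_add, Nat.cast_one] at h3
    exact one_ne_zero h3⟩
  let L := CyclotomicField (q ^ r - 1) k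
  have : FiniteDimensional k L := IsCyclotomicExtension.finiteDimensional {q ^ r - 1} k L
  have : IsGalois k L := IsCyclotomicExtension.isGalois {q ^ r - 1} k L
  let : NormedField L := spectralNorm.normedField k L
  let : NormedAlgebra k L := spectralNorm.normedAlgebra k L
  have : IsUltrametricDist L :=
    IsUltrametricDist.isUltrametricDist_of_isNonarchimedean_norm
      (isNonarchimedean_spectralNorm (K := k) (L := L))
  have hiso : ∀ (g : L ≃ₐ[k] L) (x : L), ‖g x‖ = ‖x‖ := fun g x =>
    (spectralNorm_eq_of_equiv g x).symm
  obtain ⟨h1, ⟨σ, hσ⟩, h2⟩ := exists_frobenius_of_isCyclotomicExtension (k := k) (L := L) hr hiso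
  exact ⟨L, inferInstance, inferInstance, inferInstance, inferInstance, inferInstance, h1, σ, hσ,
    hiso σ, h2⟩

end ResidueField

/-- A central division algebra of degree `r` over a local field, with its reduced norm, whose
absolute value is ultrametric. -/
theorem exists_centralDivisionAlgebra (k : Type u) [NontriviallyNormedField k]
    [IsUltrametricDist k] [LocallyCompactSpace k] {r : ℕ} (hr : 0 < r) :
    ∃ (L : Type u) (_ : Field L) (_ : Algebra k L) (D : Type u) (_ : DivisionRing D)
      (_ : Algebra k D) (f : D →ₐ[k] Matrix (Fin r) (Fin r) L) (nrd : D → k),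
      Algebra.IsCentral k D ∧ Module.finrank k D = r ^ 2 ∧ IsReducedNorm k D r nrd ∧
      (∀ a, algebraMap k L (nrd a) = (f a).det) ∧ (∀ a, nrd a = 0 ↔ a = 0) ∧
      ∀ a b, ‖nrd (a + b)‖ ≤ max ‖nrd a‖ ‖nrd b‖ := by
  have : NeZero r := ⟨hr.ne'⟩
  obtain ⟨L, _, _, _, _, _, hdeg, σ, hord, hiso, hnorm⟩ := exists_unramified_cyclic_extension k hr
  obtain ⟨π, hπ0, hπ1, hπval⟩ := exists_uniformizer k
  have hπpos : 0 < ‖π‖ := norm_pos_iff.mpr hπ0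
  have hval : ∀ x : L, x ≠ 0 → ∃ m : ℤ, ‖x‖ = ‖algebraMap k L π‖ ^ m := by
    intro x hx
    obtain ⟨c, hc⟩ := hnorm x
    rw [norm_algebraMap', hc]
    refine hπval c fun h => hx ?_
    rwa [h, norm_zero, norm_eq_zero] at hc
  -- The norm an r-th root of π would have.
  let ρ : ℝ := ‖π‖ ^ ((1 : ℝ) / r)
  have hρ : 0 < ρ := Real.rpow_pos_of_pos hπpos _
  have hρπ : ρ ^ r = ‖algebraMap k L π‖ := by
    rw [norm_algebraMap', ← Real.rpow_natCast, ← Real.rpow_mul hπpos.le,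
      one_div_mul_cancel (by exact_mod_cast hr.ne'), Real.rpow_one]
  have hρ1 : ρ ≠ 1 := fun h => by
    rw [h, one_pow, norm_algebraMap'] at hρπ
    exact hπ1.ne hρπ.symm
  have hσr : σ ^ r = 1 := hord ▸ pow_orderOf_eq_one σ
  have hgen : ∀ τ : L ≃ₐ[k] L, τ ∈ Subgroup.zpowers σ := by
    have : Subgroup.zpowers σ = ⊤ := by
      apply Subgroup.eq_top_of_card_eq
      rw [Nat.card_zpowers, hord, IsGalois.card_aut_eq_finrank, hdeg]
    intro τ
    rw [this]
    exact Subgroup.mem_top τ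
  let D := cyclicAlgebra σ π r
  have hdet0 : ∀ a : D, (a : Matrix (Fin r) (Fin r) L).det = 0 ↔ a = 0 := fun a => by
    rw [det_eq_zero_iff_of_mem_cyclicAlgebra hπ0 hiso hρ hρ1 hρπ hval a.2]
    exact ⟨fun h => Subtype.ext h, fun h => congrArg Subtype.val h⟩
  have : NoZeroDivisors D := ⟨fun {a b} hab => by
    rw [← hdet0, ← hdet0, ← mul_eq_zero, ← Matrix.det_mul]
    exact (hdet0 _).mpr hab⟩
  have : IsDomain D := NoZeroDivisors.to_isDomain D
  have hcentral : Algebra.IsCentral k D := cyclicAlgebra_isCentral hord hgen hπ0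
  have hdim : Module.finrank k D = r ^ 2 := by
    rw [finrank_cyclicAlgebra hπ0 hiso hρ hρπ hσr, hdeg, sq]
  have hfixed : ∀ a : D, ∃ c : k, algebraMap k L c = (a : Matrix (Fin r) (Fin r) L).det := by
    intro a
    refine (IsGalois.mem_range_algebraMap_iff_fixed _).mpr fun τ => ?_
    have h1 : σ ∈ MulAction.stabilizer (L ≃ₐ[k] L) (a : Matrix (Fin r) (Fin r) L).det :=
      apply_det_of_mem_cyclicAlgebra hπ0 a.2
    exact (Subgroup.zpowers_le.mpr h1) (hgen τ)
  choose nrd hnrd using hfixed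
  have hnorm' : ∀ a : D, ‖nrd a‖ = ‖(a : Matrix (Fin r) (Fin r) L).det‖ := fun a => by
    rw [← hnrd, norm_algebraMap']
  refine ⟨L, inferInstance, inferInstance, D, divisionRingOfFiniteDimensional k D, inferInstance,
    D.val, nrd, hcentral, hdim, isReducedNorm_of_algHom hdim D.val nrd hnrd, hnrd, fun a => ?_,
    fun a b => ?_⟩
  · rw [← map_eq_zero_iff _ (algebraMap k L).injective, hnrd]
    exact hdet0 a
  · rw [hnorm', hnorm', hnorm']
    exact norm_det_add_le hπ0 hiso hρ hρ1 hρπ hval a.2 b.2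

/-! ### Passage from the division algebra to V -/

theorem isNonarchVectorNorm_of_pow {k : Type u} {V : Type v} [NormedField k] [AddCommGroup V]
    [Module k V] {r : ℕ} (hr : 0 < r) {ν : V → k} (h0 : ∀ x, ν x = 0 ↔ x = 0)
    (hsmul : ∀ (a : k) x, ν (a • x) = a ^ r * ν x)
    (hadd : ∀ x y, ‖ν (x + y)‖ ≤ max ‖ν x‖ ‖ν y‖) :
    IsNonarchVectorNorm k (fun x : V => ‖ν x‖ ^ ((1 : ℝ) / (r : ℝ))) := by
  have hr' : (0 : ℝ) < 1 / r := by positivity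
  have hnn : ∀ x, 0 ≤ ‖ν x‖ ^ ((1 : ℝ) / (r : ℝ)) := fun x => Real.rpow_nonneg (norm_nonneg _) _
  have hmax : ∀ x y, ‖ν (x + y)‖ ^ ((1 : ℝ) / (r : ℝ)) ≤
      max (‖ν x‖ ^ ((1 : ℝ) / (r : ℝ))) (‖ν y‖ ^ ((1 : ℝ) / (r : ℝ))) := by
    intro x y
    rcases le_max_iff.mp (hadd x y) with h | h
    · exact le_max_of_le_left (Real.rpow_le_rpow (norm_nonneg _) h hr'.le)
    · exact le_max_of_le_right (Real.rpow_le_rpow (norm_nonneg _) h hr'.le)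
  refine ⟨⟨hnn, fun x => ?_, fun a x => ?_, fun x y => ?_⟩, hmax⟩
  · rw [Real.rpow_eq_zero (norm_nonneg _) hr'.ne', norm_eq_zero, h0]
  · rw [hsmul, norm_mul, norm_pow, Real.mul_rpow (pow_nonneg (norm_nonneg _) _) (norm_nonneg _),
      one_div, Real.pow_rpow_inv_natCast (norm_nonneg _) hr.ne']
  · exact (hmax x y).trans (max_le_add_of_nonneg (hnn x) (hnn y))

theorem proposition3p1 :
    (∀ (V : Type v) [AddCommGroup V] [Module ℝ V] [FiniteDimensional ℝ V]
        (Q : QuadraticForm ℝ V), Q.PosDef →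
        IsVectorNorm ℝ (fun x : V => |Q x| ^ ((1 : ℝ) / 2))) ∧
    (∀ (k : Type u) [NontriviallyNormedField k] [IsUltrametricDist k] [LocallyCompactSpace k]
        (V : Type v) [AddCommGroup V] [Module k V] [FiniteDimensional k V]
        (r : ℕ), 0 < r → Module.finrank k V ≤ r ^ 2 →
        ∃ ν : V → k,
          IsHomogeneousPolynomialFunction k r ν ∧
          (∀ x, ν x = 0 ↔ x = 0) ∧
          IsNonarchVectorNorm k (fun x : V => ‖ν x‖ ^ ((1 : ℝ) / (r : ℝ))) ∧
          ∃ (D : Type u) (_ : DivisionRing D) (_ : Algebra k D) (nrd : D → k) (ι : V →ₗ[k] D),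
            Algebra.IsCentral k D ∧ Module.finrank k D = r ^ 2 ∧
            IsReducedNorm k D r nrd ∧ Function.Injective ι ∧ ∀ x, ν x = nrd (ι x)) := by
  refine ⟨fun V _ _ _ Q hQ => QuadraticForm.PosDef.isVectorNorm hQ, fun k _ _ _ V _ _ _ r hr hV => ?_⟩
  obtain ⟨L, _, _, D, _, _, f, nrd, hcentral, hdim, hred, hdet, h0, hadd⟩ :=
    exists_centralDivisionAlgebra k hr
  have : FiniteDimensional k D := Module.finite_of_finrank_pos (by rw [hdim]; positivity)
  obtain ⟨ι, hι⟩ : ∃ ι : V →ₗ[k] D, Function.Injective ι := by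
    rw [← lift_rank_le_iff_exists_linearMap, ← Module.finrank_eq_rank, ← Module.finrank_eq_rank,
      Cardinal.lift_natCast, Cardinal.lift_natCast, Nat.cast_le]
    exact hV.trans hdim.ge
  -- Degree r homogeneity comes from the determinant of an r × r matrix.
  have hsmul : ∀ (a : k) (x : D), nrd (a • x) = a ^ r * nrd x := fun a x => by
    apply (algebraMap k L).injective
    rw [hdet, map_smul, map_mul, hdet, map_pow, ← algebraMap_smul L a (f x), Matrix.det_smul,
      Fintype.card_fin]
  have h0' : ∀ x, nrd (ι x) = 0 ↔ x = 0 := fun x => by rw [h0, map_eq_zero_iff ι hι]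
  refine ⟨fun x => nrd (ι x), ?_, h0', ?_, D, inferInstance, inferInstance, nrd, ι, hcentral, hdim,
    hred, hι, fun x => rfl⟩
  · exact isHomogeneousPolynomialFunction_of_det (f.toLinearMap.comp ι) _ fun x => hdet (ι x)
  · exact isNonarchVectorNorm_of_pow hr h0' (fun a x => by rw [map_smul, hsmul])
      fun x y => by rw [map_add]; exact hadd _ _
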